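/- Let $n\ge 2$. Let $\widetilde{\mathcal C}_+$ be the space of complex-valued $C^\infty$ functions on $\mathbb R^n\setminus\{0\}$ with bounded support, and let $\widetilde{\mathcal C}_-$ be the space of complex-valued $C^\infty$ functions on $(\mathbb R^n)^*\setminus\{0\}$ that vanish in a neighborhood of $0$. For $f\in\widetilde{\mathcal C}_+$ and $\xi\in(\mathbb R^n)^*\setminus\{0\}$ put $$\mathcal M f(\xi)=\int_{\langle \xi,x\rangle=1} f(x)\,d\mu_\xi ,$$ where $\mu_\xi$ is the measure on the hyperplane $\langle\xi,x\rangle=t$ (here with $t=1$) normalized by $d\mu_\xi\,dt=dx$, i.e. $(n-1)$-dimensional Euclidean Lebesgue measure on the hyperplane divided by $\|\xi\|$. Then: 1. $\mathcal M$ maps $\widetilde{\mathcal C}_+$ into $\widetilde{\mathcal C}_-$. 2. The operator $\mathcal M:\widetilde{\mathcal C}_+\to\widetilde{\mathcal C}_-$ is not surjective. 3. For every $f\in\widetilde{\mathcal C}_+$, $0\notin\operatorname{supp}(\mathcal M f)$ and the connected component containing $0$ of $(\mathbb R^n)^*\setminus\operatorname{supp}(\mathcal M f)$ is convex, where $\operatorname{supp}$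 denotes the closure in $(\mathbb R^n)^*$ of the set of points where the function is nonzero. -/

import Mathlib

open Set Topology MeasureTheory
open scoped ContDiff

namespace Radon

/-- Euclidean space `ℝⁿ`. -/
abbrev E (n : ℕ) : Type := EuclideanSpace ℝ (Fin n)

/-- The dual space `(ℝⁿ)*`; the pairing `⟨ξ, x⟩` is evaluation `ξ x`. -/
abbrev EDual (n : ℕ) : Type := StrongDual ℝ (E n)

/-- The punctured space `V ∖ {0}`. -/
abbrev Punctured (V : Type*) [Zero V] : Type _ := {x : V // x ≠ 0}

open Classical in
/-- The extension by `0` at the origin of a function on `V ∖ {0}`. -/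
noncomputable def zeroExt {V : Type*} [Zero V] (f : Punctured V → ℂ) : V → ℂ :=
  fun x => if h : x ≠ 0 then f ⟨x, h⟩ else 0

section Spaces

variable (V : Type*) [NormedAddCommGroup V] [NormedSpace ℝ V]

/-- The `C^∞` complex-valued functions on `V ∖ {0}` with bounded support (no condition is imposed
on the behaviour near `0`). -/
def smoothBounded : Set (Punctured V → ℂ) :=
  {f | ContDiffOn ℝ ∞ (zeroExt f) {0}ᶜ ∧ ∃ R : ℝ, ∀ x : Punctured V, f x ≠ 0 → ‖(x : V)‖ ≤ R}

/-- The `C^∞` complex-valued functions on `V ∖ {0}` that vanish in a neighbourhood of `0`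
(no condition is imposed at infinity). -/
def smoothAway : Set (Punctured V → ℂ) :=
  {g | ContDiffOn ℝ ∞ (zeroExt g) {0}ᶜ ∧
    ∃ r : ℝ, 0 < r ∧ ∀ x : Punctured V, g x ≠ 0 → r ≤ ‖(x : V)‖}

end Spaces

section Transform

variable {n : ℕ}

/-- The point of the hyperplane `⟨ξ, x⟩ = 1` that is closest to `0`. -/
noncomputable def foot (ξ : EDual n) : E n :=
  (‖ξ‖ ^ 2)⁻¹ • (InnerProductSpace.toDual ℝ (E n)).symm ξ

/-- The measure on the hyperplane `⟨ξ, x⟩ = t` (viewed as a measure on `ℝⁿ`): the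
`(n - 1)`-dimensional Lebesgue measure of `ker ξ`, translated to the hyperplane and divided by
`‖ξ‖`. It satisfies `dμ dt = dx`, see `lintegral_hyperplaneMeasure`. -/
noncomputable def hyperplaneMeasure (ξ : EDual n) (t : ℝ) : Measure (E n) :=
  ENNReal.ofReal ‖ξ‖⁻¹ •
    (volume : Measure ξ.ker).map (fun y : ξ.ker => (y : E n) + t • foot ξ)

/-- The operator `Mf(ξ) = ∫_{⟨ξ, x⟩ = 1} f(x) dμ_ξ`. -/
noncomputable def radonM (f : Punctured (E n) → ℂ) : Punctured (EDual n) → ℂ :=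
  fun ξ => ∫ x, zeroExt f x ∂(hyperplaneMeasure (ξ : EDual n) 1)

theorem apply_foot {ξ : EDual n} (hξ : ξ ≠ 0) : ξ (foot ξ) = 1 := by
  have h : ξ ((InnerProductSpace.toDual ℝ (E n)).symm ξ) = ‖ξ‖ ^ 2 := by
    rw [← InnerProductSpace.toDual_symm_apply, real_inner_self_eq_norm_sq,
      LinearIsometryEquiv.norm_map]
  have : ‖ξ‖ ≠ 0 := norm_ne_zero_iff.2 hξ
  rw [foot, map_smul, h, smul_eq_mul, inv_mul_cancel₀ (by positivity)]

/-- The measure is carried by the hyperplane `⟨ξ, x⟩ = t`. -/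
theorem hyperplaneMeasure_ne {ξ : EDual n} (hξ : ξ ≠ 0) (t : ℝ) :
    hyperplaneMeasure ξ t {x | ξ x ≠ t} = 0 := by
  have hm : MeasurableSet {x : E n | ξ x ≠ t} :=
    (isClosed_eq ξ.continuous continuous_const).measurableSet.compl
  have hf : Measurable (fun y : ξ.ker => (y : E n) + t • foot ξ) := by fun_prop
  rw [hyperplaneMeasure, Measure.smul_apply, Measure.map_apply hf hm]
  have : (fun y : ξ.ker => (y : E n) + t • foot ξ) ⁻¹' {x | ξ x ≠ t} = ∅ := by
    ext y
    simp [apply_foot hξ]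
  simp [this]

/-- The normalization `dμ dt = dx`. -/
theorem lintegral_hyperplaneMeasure {ξ : EDual n} (hξ : ξ ≠ 0) {s : Set (E n)}
    (hs : MeasurableSet s) : ∫⁻ t : ℝ, hyperplaneMeasure ξ t s = volume s := by
  have hn : ‖ξ‖ ≠ 0 := norm_ne_zero_iff.2 hξ
  have hmem : foot ξ ∈ ξ.kerᗮ := by
    rw [Submodule.mem_orthogonal']
    intro y hy
    have hy' : ξ y = 0 := hy
    rw [foot, real_inner_smul_left, InnerProductSpace.toDual_symm_apply, hy', mul_zero]
  have hnorm : ‖foot ξ‖ = ‖ξ‖⁻¹ := by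
    rw [foot, norm_smul, LinearIsometryEquiv.norm_map, norm_inv, norm_pow, norm_norm]
    field_simp
  set v : ξ.kerᗮ := ⟨foot ξ, hmem⟩ with hv
  have hv0 : v ≠ 0 := by
    intro h
    have : foot ξ = 0 := congrArg Subtype.val h
    rw [this, norm_zero] at hnorm
    exact (inv_ne_zero hn) hnorm.symm
  have hrank : Module.finrank ℝ ξ.kerᗮ = 1 := by
    have h1 := Submodule.finrank_add_finrank_orthogonal ξ.ker
    have h2 := LinearMap.finrank_range_add_finrank_ker (ξ : E n →ₗ[ℝ] ℝ)
    have h3 : LinearMap.range (ξ : E n →ₗ[ℝ] ℝ) = ⊤ := by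
      refine LinearMap.range_eq_top.2 fun t => ⟨t • foot ξ, ?_⟩
      simp [apply_foot hξ]
    rw [h3, finrank_top, Module.finrank_self] at h2
    change _ + Module.finrank ℝ ξ.ker = _ at h2
    omega
  have hvol := volume_eq_of_finrank_eq_one hrank hv0
  have hmp : MeasurePreserving
      (fun p : ξ.ker × ξ.kerᗮ => (p.1 : E n) + (p.2 : E n)) := by
    have h := (ξ.ker.orthogonalDecomposition.symm.measurePreserving).comp
      (WithLp.volume_preserving_toLp ξ.ker ξ.kerᗮ)
    convert h using 1
    funext p
    simp
  rw [← hmp.measure_preimage hs.nullMeasurableSet, Measure.volume_eq_prod,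
    Measure.prod_apply_symm (hmp.measurable hs), hvol, lintegral_smul_measure,
    lintegral_map' _ (by fun_prop)]
  · have hc : ‖v‖ₑ = ENNReal.ofReal ‖ξ‖⁻¹ := by
      rw [← ofReal_norm, ← hnorm]; rfl
    rw [hc, smul_eq_mul, ← lintegral_const_mul' _ _ ENNReal.ofReal_ne_top]
    refine lintegral_congr fun t => ?_
    rw [hyperplaneMeasure, Measure.smul_apply, Measure.map_apply (by fun_prop) hs]
    rfl
  · exact (measurable_measure_prodMk_right (hmp.measurable hs)).aemeasurable

end Transform

end Radon

/-! Statements 1 and 3 imply statement 2: a bump around some `α ≠ 0` lies in `smoothAway`, but `0`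
and `2α` can be joined around it, so the component of `0` off its support misses the midpoint `α`
and is not convex (`exists_smoothAway_not_convex`).

For statement 3 the component is identified: it is the interior of the convex set `polarSupport f`
(`connectedComponentIn_compl_tsupport_radonM`). The key is the local support theorem
`zeroExt_eq_zero_of_radonM_eq_zero`. By homogeneity, vanishing of `Mf` on the segment from `0` to
`ξ` says that the integrals of `f` over `⟨ξ, x⟩ = t` vanish for all `t ≥ 1`, so `f` integrates to
zero against `φ (ξ x)` whenever `φ = 0` on `(-∞, 1]`. When this holds for `ξ` in an open set,
differentiating in `ξ` yields all moments of `φ (ξ x) f(x)`. Its support is bounded, so its Fourier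
transform vanishes, and hence so does the function.

Statement 1 rests on writing the hyperplane measures near `ξ₀` as integrals over the fixed space
`ker ξ₀`. -/

namespace Radon

/-! ### Hyperplane measures: disintegration, homogeneity, local charts -/

section Measures

variable {n : ℕ}

theorem volume_eq_smul_map_prod {ξ : EDual n} (hξ : ξ ≠ 0) :
    (volume : Measure (E n)) = ENNReal.ofReal ‖ξ‖⁻¹ •
      ((volume : Measure ξ.ker).prod (volume : Measure ℝ)).map
        (fun p : ξ.ker × ℝ => (p.1 : E n) + p.2 • foot ξ) := by
  have hm : Measurable (fun p : ξ.ker × ℝ => (p.1 : E n) + p.2 • foot ξ) := by fun_prop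
  ext s hs
  rw [Measure.smul_apply, Measure.map_apply hm hs, Measure.prod_apply_symm (hm hs),
    ← lintegral_hyperplaneMeasure hξ hs, smul_eq_mul,
    ← lintegral_const_mul' _ _ ENNReal.ofReal_ne_top]
  refine lintegral_congr fun t => ?_
  rw [hyperplaneMeasure, Measure.smul_apply, Measure.map_apply (by fun_prop) hs]
  rfl

theorem integral_hyperplaneMeasure_eq {F : Type*} [NormedAddCommGroup F] [NormedSpace ℝ F]
    (ξ : EDual n) (t : ℝ) (f : E n → F) :
    ∫ x, f x ∂(hyperplaneMeasure ξ t) = ‖ξ‖⁻¹ • ∫ y : ξ.ker, f ((y : E n) + t • foot ξ) := by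
  have he : MeasurableEmbedding (fun y : ξ.ker => (y : E n) + t • foot ξ) :=
    ((Homeomorph.addRight (t • foot ξ)).isClosedEmbedding.comp
      (ξ.isClosed_ker.isClosedEmbedding_subtypeVal)).measurableEmbedding
  rw [hyperplaneMeasure, integral_smul_measure, he.integral_map,
    ENNReal.toReal_ofReal (by positivity)]

theorem integral_integral_hyperplaneMeasure {F : Type*} [NormedAddCommGroup F] [NormedSpace ℝ F]
    {ξ : EDual n} (hξ : ξ ≠ 0) {f : E n → F} (hf : Integrable f) :
    ∫ t : ℝ, ∫ x, f x ∂(hyperplaneMeasure ξ t) = ∫ x, f x := by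
  have hn : 0 < ‖ξ‖ := norm_pos_iff.2 hξ
  have hm : Measurable (fun p : ξ.ker × ℝ => (p.1 : E n) + p.2 • foot ξ) := by fun_prop
  have hvol := volume_eq_smul_map_prod hξ
  rw [hvol] at hf
  have hf' : Integrable f (((volume : Measure ξ.ker).prod (volume : Measure ℝ)).map
        (fun p : ξ.ker × ℝ => (p.1 : E n) + p.2 • foot ξ)) :=
    (integrable_smul_measure (by simpa using hξ) ENNReal.ofReal_ne_top).1 hf
  rw [hvol, integral_smul_measure, integral_map hm.aemeasurable hf'.aestronglyMeasurable,
    integral_prod_symm (fun p : ξ.ker × ℝ => f ((p.1 : E n) + p.2 • foot ξ))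
      (hf'.comp_measurable hm), ENNReal.toReal_ofReal (by positivity),
    ← integral_smul]
  simp_rw [integral_hyperplaneMeasure_eq]

theorem foot_smul (ξ : EDual n) {c : ℝ} (hc : c ≠ 0) : foot (c • ξ) = c⁻¹ • foot ξ := by
  rcases eq_or_ne ξ 0 with rfl | hξ
  · simp [foot]
  have : ‖ξ‖ ≠ 0 := norm_ne_zero_iff.2 hξ
  rw [foot, foot, map_smulₛₗ, smul_smul, smul_smul, norm_smul, mul_pow, Real.norm_eq_abs, sq_abs]
  congr 1
  simp
  field_simp

/-- The hyperplanes `⟨ξ, x⟩ = t` and `⟨t⁻¹ξ, x⟩ = 1` coincide; only the normalizations differ.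
Values of `Mf` along a ray thus become integrals over parallel hyperplanes. -/
theorem hyperplaneMeasure_smul (ξ : EDual n) {t : ℝ} (ht : 0 < t) :
    hyperplaneMeasure (t⁻¹ • ξ) 1 = ENNReal.ofReal t • hyperplaneMeasure ξ t := by
  have hker : (t⁻¹ • ξ).ker = ξ.ker := by
    ext x; simp [ht.ne']
  have aux : ∀ (W W' : Submodule ℝ (E n)), W = W' → ∀ w : E n,
      (volume : Measure W).map (fun y : W => (y : E n) + w) =
      (volume : Measure W').map (fun y : W' => (y : E n) + w) := by
    rintro W _ rfl w; rfl
  rw [hyperplaneMeasure, hyperplaneMeasure, smul_smul, aux _ _ hker,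
    foot_smul ξ (inv_ne_zero ht.ne'), inv_inv, one_smul, norm_smul, mul_inv,
    ENNReal.ofReal_mul (by positivity)]
  congr 2
  simp [abs_of_pos ht]

theorem measure_prod_preimage_shear {N : Type*} [MeasureSpace N] [SFinite (volume : Measure N)]
    {b : N → ℝ} (hb : Measurable b) {a : ℝ} (ha : 0 < a) {s : Set (N × ℝ)}
    (hs : MeasurableSet s) :
    ((volume : Measure N).prod (volume : Measure ℝ))
      ((fun p : N × ℝ => (p.1, (p.2 - b p.1) / a)) ⁻¹' s) =
      ENNReal.ofReal a * ((volume : Measure N).prod (volume : Measure ℝ)) s := by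
  have hm : Measurable (fun p : N × ℝ => (p.1, (p.2 - b p.1) / a)) := by fun_prop
  rw [Measure.prod_apply (hm hs), Measure.prod_apply hs,
    ← lintegral_const_mul' _ _ ENNReal.ofReal_ne_top]
  refine lintegral_congr fun y => ?_
  have : Prod.mk y ⁻¹' ((fun p : N × ℝ => (p.1, (p.2 - b p.1) / a)) ⁻¹' s) =
      (fun t => t - b y) ⁻¹' ((fun t => t * a⁻¹) ⁻¹' (Prod.mk y ⁻¹' s)) := by
    ext t; simp [div_eq_mul_inv]
  rw [this]
  simp_rw [sub_eq_add_neg]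
  rw [measure_preimage_add_right, Real.volume_preimage_mul_right (inv_ne_zero ha.ne'),
    inv_inv, abs_of_pos ha]

/-- The projection of `ker ξ₀` onto `ker ξ` along a vector transversal to both. -/
noncomputable def kerEquiv (ξ₀ ξ : EDual n) (v : E n) (h₀ : ξ₀ v = 1) (h : ξ v ≠ 0) :
    ξ₀.ker ≃L[ℝ] ξ.ker where
  toFun y := ⟨(y : E n) - (ξ y / ξ v) • v, by simp [h]⟩
  invFun z := ⟨(z : E n) - (ξ₀ z) • v, by simp [h₀]⟩
  map_add' x y := by
    ext1
    simp only [Submodule.coe_add, map_add, add_div, add_smul]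
    abel
  map_smul' c x := by
    ext1
    simp only [Submodule.coe_smul, map_smul, smul_eq_mul, mul_div_assoc, mul_smul, smul_sub,
      RingHom.id_apply]
  left_inv y := by
    ext1
    have hy : ξ₀ (y : E n) = 0 := y.2
    simp [h₀, hy]
  right_inv z := by
    ext1
    have hz : ξ (z : E n) = 0 := z.2
    simp [hz, neg_div, h]
  continuous_toFun := by fun_prop
  continuous_invFun := by fun_prop

theorem coe_kerEquiv (ξ₀ ξ : EDual n) (v : E n) (h₀ : ξ₀ v = 1) (h : ξ v ≠ 0) (y : ξ₀.ker) :
    (kerEquiv ξ₀ ξ v h₀ h y : E n) = (y : E n) - (ξ y / ξ v) • v := rfl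

/-- The measure on `⟨ξ, x⟩ = t` in the chart given by projection along `foot ξ₀` to `ker ξ₀`. -/
theorem hyperplaneMeasure_eq_chart {ξ₀ ξ : EDual n} (hξ₀ : ξ₀ ≠ 0) (hv : 0 < ξ (foot ξ₀))
    (t : ℝ) :
    hyperplaneMeasure ξ t = ENNReal.ofReal (‖ξ₀‖⁻¹ * (ξ (foot ξ₀))⁻¹) •
      (volume : Measure ξ₀.ker).map
        (fun y : ξ₀.ker => (y : E n) + ((t - ξ y) / ξ (foot ξ₀)) • foot ξ₀) := by
  set v := foot ξ₀ with hvdef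
  have hξ : ξ ≠ 0 := by rintro rfl; simp at hv
  have hn : 0 < ‖ξ‖ := norm_pos_iff.2 hξ
  have h₀ : ξ₀ v = 1 := apply_foot hξ₀
  set L := kerEquiv ξ₀ ξ v h₀ hv.ne'
  have hL : ((volume : Measure ξ₀.ker).map L).IsAddHaarMeasure := L.isAddHaarMeasure_map _
  -- The Jacobian `c` of the projection is never computed: uniqueness of Haar measure gives
  -- proportionality with a factor `C` independent of `t`, and integrating over `t` forces `C = 1`,
  -- since both families disintegrate Lebesgue measure.
  obtain ⟨c, hc, hcL⟩ : ∃ c : ENNReal, c ≠ ⊤ ∧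
      (volume : Measure ξ₀.ker).map L = c • (volume : Measure ξ.ker) :=
    ⟨_, ENNReal.coe_ne_top, Measure.isAddLeftInvariant_eq_smul _ _⟩
  set k := ENNReal.ofReal (‖ξ₀‖⁻¹ * (ξ v)⁻¹)
  set C := k * c * ENNReal.ofReal ‖ξ‖ with hC
  have key : ∀ t : ℝ, k • (volume : Measure ξ₀.ker).map
        (fun y : ξ₀.ker => (y : E n) + ((t - ξ y) / ξ v) • v) = C • hyperplaneMeasure ξ t := by
    intro t
    have hw : (t / ξ v) • v - t • foot ξ ∈ ξ.ker := by
      simp [apply_foot hξ, hv.ne']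
    set w : ξ.ker := ⟨_, hw⟩ with hwdef
    have h1 : (fun y : ξ₀.ker => (y : E n) + ((t - ξ y) / ξ v) • v) =
        (fun z : ξ.ker => (z : E n) + t • foot ξ) ∘ (fun z => z + w) ∘ L := by
      funext y
      simp only [Function.comp_apply, Submodule.coe_add, hwdef, L, coe_kerEquiv, sub_div, sub_smul]
      abel
    rw [h1, ← Measure.map_map (by fun_prop) (by fun_prop),
      ← Measure.map_map (by fun_prop) (by fun_prop), hcL, Measure.map_smul, Measure.map_smul,
      map_add_right_eq_self, hyperplaneMeasure, smul_smul, smul_smul]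
    congr 1
    rw [hC, mul_assoc _ (ENNReal.ofReal ‖ξ‖), ← ENNReal.ofReal_mul hn.le,
      mul_inv_cancel₀ hn.ne', ENNReal.ofReal_one, mul_one]
  have tot : ∀ s : Set (E n), MeasurableSet s → C * volume s = volume s := by
    intro s hs
    have hm : Measurable (fun p : ξ₀.ker × ℝ => (p.1 : E n) + p.2 • v) := by fun_prop
    have hm' : Measurable (fun p : ξ₀.ker × ℝ =>
      (p.1 : E n) + ((p.2 - ξ p.1) / ξ v) • v) := by fun_prop
    have hCtop : C ≠ ⊤ := by finiteness
    rw [← lintegral_hyperplaneMeasure hξ hs, ← lintegral_const_mul' _ _ hCtop]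
    have : ∀ t, C * hyperplaneMeasure ξ t s =
        k * (volume : Measure ξ₀.ker) ((fun y : ξ₀.ker => (y, t)) ⁻¹'
          ((fun p : ξ₀.ker × ℝ => (p.1 : E n) + ((p.2 - ξ p.1) / ξ v) • v) ⁻¹' s)) := by
      intro t
      rw [← smul_eq_mul, ← Measure.smul_apply, ← key t, Measure.smul_apply,
        Measure.map_apply (by fun_prop) hs, smul_eq_mul]
      rfl
    simp_rw [this]
    rw [lintegral_const_mul' _ _ ENNReal.ofReal_ne_top, ← Measure.prod_apply_symm (hm' hs),
      lintegral_hyperplaneMeasure hξ hs]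
    have hpre : (fun p : ξ₀.ker × ℝ => (p.1 : E n) + ((p.2 - ξ p.1) / ξ v) • v) ⁻¹' s =
        (fun p : ξ₀.ker × ℝ => (p.1, (p.2 - ξ p.1) / ξ v)) ⁻¹'
          ((fun p : ξ₀.ker × ℝ => (p.1 : E n) + p.2 • v) ⁻¹' s) := rfl
    rw [hpre, measure_prod_preimage_shear (b := fun y : ξ₀.ker => ξ y) (by fun_prop) hv (hm hs),
      ← mul_assoc, ← ENNReal.ofReal_mul (by positivity), mul_assoc, inv_mul_cancel₀ hv.ne', mul_one]
    conv_rhs => rw [volume_eq_smul_map_prod hξ₀]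
    rw [Measure.smul_apply, Measure.map_apply hm hs, smul_eq_mul]
  have hC1 : C = 1 := by
    have h := tot (Metric.ball 0 1) measurableSet_ball
    have h0 : volume (Metric.ball (0 : E n) 1) ≠ 0 := (Metric.measure_ball_pos _ _ one_pos).ne'
    rwa [ENNReal.mul_eq_right h0 measure_ball_lt_top.ne] at h
  rw [key t, hC1, one_smul]

end Measures

/-! ### Extension by zero and smooth parameter integrals -/

section ZeroExt

variable {V : Type*} [Zero V]

theorem zeroExt_zero (f : Punctured V → ℂ) : zeroExt f 0 = 0 := by
  simp [zeroExt]

theorem zeroExt_of_ne (f : Punctured V → ℂ) {x : V} (hx : x ≠ 0) : zeroExt f x = f ⟨x, hx⟩ := by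
  simp [zeroExt, hx]

theorem zeroExt_restrict {g : V → ℂ} (h0 : g 0 = 0) :
    zeroExt (fun x : Punctured V => g x) = g := by
  funext x
  rcases eq_or_ne x 0 with rfl | hx
  · rw [zeroExt_zero, h0]
  · rw [zeroExt_of_ne _ hx]

end ZeroExt

/-- The integral is the convolution of the constant `1` with `g p`, evaluated at `0`, so smoothness
of convolutions with parameters applies. -/
theorem contDiffOn_integral_of_compact {P G F : Type*}
    [NormedAddCommGroup P] [NormedSpace ℝ P] [NormedAddCommGroup G] [NormedSpace ℝ G]
    [NormedAddCommGroup F] [NormedSpace ℝ F] [CompleteSpace F] [MeasurableSpace G] [BorelSpace G]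
    [FiniteDimensional ℝ G] (μ : Measure G) [μ.IsAddHaarMeasure]
    {g : P → G → F} {s : Set P} {k : Set G} (hs : IsOpen s) (hk : IsCompact k)
    (hgs : ∀ p, ∀ x, p ∈ s → x ∉ k → g p x = 0)
    (hg : ContDiffOn ℝ ∞ (fun q : P × G => g q.1 q.2) (s ×ˢ univ)) :
    ContDiffOn ℝ ∞ (fun p => ∫ x, g p x ∂μ) s := by
  have h := contDiffOn_convolution_right_with_param_comp (μ := μ) (n := ⊤)
    (ContinuousLinearMap.lsmul ℝ ℝ : ℝ →L[ℝ] F →L[ℝ] F) (v := fun _ : P => (0 : G))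
    (f := fun _ => (1 : ℝ)) contDiffOn_const hs hk hgs (locallyIntegrable_const _) hg
  refine h.congr fun p _ => ?_
  simp only [MeasureTheory.convolution, ContinuousLinearMap.lsmul_apply, one_smul]
  exact (integral_sub_left_eq_self (g p) μ 0).symm

/-! ### The transform maps `smoothBounded` into `smoothAway` -/

section Transform

variable {n : ℕ}

theorem smoothBounded.exists_bound {V : Type*} [NormedAddCommGroup V] [NormedSpace ℝ V]
    {f : Punctured V → ℂ} (hf : f ∈ smoothBounded V) :
    ∃ R : ℝ, 0 < R ∧ ∀ x, zeroExt f x ≠ 0 → ‖x‖ ≤ R := by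
  obtain ⟨-, R, hR⟩ := hf
  refine ⟨max R 1, by positivity, fun x hx => ?_⟩
  have hx0 : x ≠ 0 := by rintro rfl; exact hx (zeroExt_zero f)
  rw [zeroExt_of_ne f hx0] at hx
  exact (hR _ hx).trans (le_max_left _ _)

theorem zeroExt_radonM (f : Punctured (E n) → ℂ) (ξ : EDual n) :
    zeroExt (radonM f) ξ = ∫ x, zeroExt f x ∂(hyperplaneMeasure ξ 1) := by
  rcases eq_or_ne ξ 0 with rfl | hξ
  -- At `ξ = 0` the factor `‖ξ‖⁻¹` is `0` by convention, so the measure is zero.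
  · simp [zeroExt_zero, hyperplaneMeasure]
  · rw [zeroExt_of_ne _ hξ, radonM]

theorem ae_hyperplaneMeasure {ξ : EDual n} (hξ : ξ ≠ 0) (t : ℝ) :
    ∀ᵐ x ∂(hyperplaneMeasure ξ t), ξ x = t :=
  hyperplaneMeasure_ne hξ t

theorem zeroExt_radonM_eq_zero {f : Punctured (E n) → ℂ} {ξ : EDual n}
    (h : ∀ x, ξ x = 1 → zeroExt f x = 0) : zeroExt (radonM f) ξ = 0 := by
  rcases eq_or_ne ξ 0 with rfl | hξ
  · exact zeroExt_zero _
  rw [zeroExt_radonM]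
  exact integral_eq_zero_of_ae ((ae_hyperplaneMeasure hξ 1).mono fun x hx => h x hx)

theorem zeroExt_radonM_eq_chart (f : Punctured (E n) → ℂ) {ξ₀ ξ : EDual n} (hξ₀ : ξ₀ ≠ 0)
    (hv : 0 < ξ (foot ξ₀)) :
    zeroExt (radonM f) ξ = (‖ξ₀‖⁻¹ * (ξ (foot ξ₀))⁻¹) • ∫ y : ξ₀.ker,
      zeroExt f ((y : E n) + ((1 - ξ y) / ξ (foot ξ₀)) • foot ξ₀) := by
  have he : MeasurableEmbedding (fun y : ξ₀.ker =>
      (y : E n) + ((1 - ξ y) / ξ (foot ξ₀)) • foot ξ₀) := by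
    refine Measurable.measurableEmbedding (by fun_prop) fun y z hyz => ?_
    have hy : ξ₀ (y : E n) = 0 := y.2
    have hz : ξ₀ (z : E n) = 0 := z.2
    have h := congrArg ξ₀ hyz
    simp only [map_add, map_smul, hy, hz, apply_foot hξ₀, smul_eq_mul, mul_one, zero_add] at h
    ext1
    simpa [h] using hyz
  rw [zeroExt_radonM, hyperplaneMeasure_eq_chart hξ₀ hv, integral_smul_measure, he.integral_map,
    ENNReal.toReal_ofReal (by positivity)]

theorem contDiffOn_radonM {f : Punctured (E n) → ℂ} (hf : f ∈ smoothBounded (E n)) :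
    ContDiffOn ℝ ∞ (zeroExt (radonM f)) {0}ᶜ := by
  obtain ⟨R, hR0, hR⟩ := smoothBounded.exists_bound hf
  intro ξ₀ hξ₀
  have hξ₀ : ξ₀ ≠ 0 := hξ₀
  set v := foot ξ₀ with hv
  have hv1 : ξ₀ v = 1 := apply_foot hξ₀
  set S : Set (EDual n) := {ξ | 0 < ξ v} with hS
  have hSo : IsOpen S := isOpen_lt continuous_const (by fun_prop)
  have hmem : ξ₀ ∈ S := by simp [hS, hv1]
  suffices h : ContDiffOn ℝ ∞ (zeroExt (radonM f)) S from
    (h.contDiffAt (hSo.mem_nhds hmem)).contDiffWithinAt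
  have hint : ContDiffOn ℝ ∞ (fun ξ : EDual n => ∫ y : ξ₀.ker,
      zeroExt f ((y : E n) + ((1 - ξ y) / ξ v) • v)) S := by
    refine contDiffOn_integral_of_compact volume hSo
      -- A point `x` of the support has chart coordinate `y = x - ξ₀ x • v` and satisfies `‖x‖ ≤ R`,
      -- which bounds `y` uniformly in `ξ`.
      (isCompact_closedBall (0 : ξ₀.ker) (R + ‖ξ₀‖ * R * ‖v‖)) ?_ ?_
    · intro ξ y hξ hy
      by_contra hne
      apply hy
      have hx := hR _ hne
      set x := (y : E n) + ((1 - ξ y) / ξ v) • v with hxdef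
      have hy0 : ξ₀ (y : E n) = 0 := y.2
      have hξx : ξ₀ x = (1 - ξ y) / ξ v := by simp [hxdef, hy0, hv1]
      have hyx : (y : E n) = x - ξ₀ x • v := by rw [hξx, hxdef]; abel
      rw [mem_closedBall_zero_iff]
      change ‖(y : E n)‖ ≤ _
      rw [hyx]
      refine (norm_sub_le _ _).trans (add_le_add hx ?_)
      rw [norm_smul]
      gcongr
      exact (ξ₀.le_opNorm x).trans (by gcongr)
    · refine hf.1.comp (t := {0}ᶜ) (f := fun q : EDual n × ξ₀.ker =>
        (q.2 : E n) + ((1 - q.1 q.2) / q.1 v) • v) ?_ ?_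
      · have h2 : ContDiff ℝ ∞ (fun q : EDual n × ξ₀.ker => (q.2 : E n)) :=
          ξ₀.ker.subtypeL.contDiff.comp contDiff_snd
        have h1 : ContDiff ℝ ∞ (fun q : EDual n × ξ₀.ker => q.1 (q.2 : E n)) :=
          contDiff_fst.clm_apply h2
        have h3 : ContDiff ℝ ∞ (fun q : EDual n × ξ₀.ker => q.1 v) :=
          contDiff_fst.clm_apply contDiff_const
        exact h2.contDiffOn.add (((contDiff_const.sub h1).contDiffOn.div h3.contDiffOn
          fun q hq => (show 0 < q.1 v from hq.1).ne').smul contDiffOn_const)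
      -- The chart point satisfies `⟨ξ, x⟩ = 1`, so it avoids the possible singularity of `f` at
      -- `0`.
      · rintro ⟨ξ, y⟩ ⟨hξ, -⟩ h0
        have hξ : ξ v ≠ 0 := (show 0 < ξ v from hξ).ne'
        have h := congrArg ξ (show (y : E n) + ((1 - ξ y) / ξ v) • v = 0 from h0)
        simp [hξ] at h
  refine ContDiffOn.congr (ContDiffOn.smul (f := fun ξ : EDual n => ‖ξ₀‖⁻¹ * (ξ v)⁻¹) ?_ hint)
    fun ξ hξ => zeroExt_radonM_eq_chart f hξ₀ hξ
  have h3 : ContDiff ℝ ∞ (fun q : EDual n => q v) := contDiff_id.clm_apply contDiff_const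
  exact contDiffOn_const.mul (h3.contDiffOn.inv fun ξ hξ => (show 0 < ξ v from hξ).ne')

theorem zeroExt_radonM_eq_zero_of_norm {f : Punctured (E n) → ℂ} {R : ℝ}
    (hR : ∀ x, zeroExt f x ≠ 0 → ‖x‖ ≤ R) {ξ : EDual n} (hξ : ‖ξ‖ * R < 1) :
    zeroExt (radonM f) ξ = 0 := by
  refine zeroExt_radonM_eq_zero fun x hx => ?_
  by_contra hne
  have h1 : (1 : ℝ) ≤ ‖ξ‖ * ‖x‖ := by
    rw [← hx]; exact (le_abs_self _).trans (ξ.le_opNorm x)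
  have h2 : ‖ξ‖ * ‖x‖ ≤ ‖ξ‖ * R := by gcongr; exact hR x hne
  linarith

theorem radonM_mem_smoothAway {f : Punctured (E n) → ℂ} (hf : f ∈ smoothBounded (E n)) :
    radonM f ∈ smoothAway (EDual n) := by
  obtain ⟨R, hR0, hR⟩ := smoothBounded.exists_bound hf
  refine ⟨contDiffOn_radonM hf, R⁻¹, by positivity, fun ξ hξ => ?_⟩
  rw [← zeroExt_of_ne (radonM f) ξ.2] at hξ
  by_contra! hlt
  refine hξ (zeroExt_radonM_eq_zero_of_norm hR ?_)
  calc ‖(ξ : EDual n)‖ * R < R⁻¹ * R := by gcongr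
    _ = 1 := inv_mul_cancel₀ hR0.ne'

theorem smoothAway.zero_notMem_tsupport {V : Type*} [NormedAddCommGroup V] [NormedSpace ℝ V]
    {g : Punctured V → ℂ} (hg : g ∈ smoothAway V) : (0 : V) ∉ tsupport (zeroExt g) := by
  obtain ⟨-, r, hr, h⟩ := hg
  rw [notMem_tsupport_iff_eventuallyEq]
  filter_upwards [Metric.ball_mem_nhds (0 : V) hr] with x hx
  rcases eq_or_ne x 0 with rfl | hx0
  · exact zeroExt_zero g
  rw [zeroExt_of_ne g hx0, Pi.zero_apply]
  by_contra hne
  exact absurd (h ⟨x, hx0⟩ hne) (not_le.2 (mem_ball_zero_iff.1 hx))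

end Transform

/-! ### Vanishing moments -/

section Moments

variable {V : Type*} [NormedAddCommGroup V] [InnerProductSpace ℝ V] [FiniteDimensional ℝ V]
  [MeasurableSpace V] [BorelSpace V]

theorem integrable_smul_of_bounded_support {F : V → ℂ} (hF : Integrable F) {R : ℝ}
    (hR : ∀ x, F x ≠ 0 → ‖x‖ ≤ R) {g : V → ℝ} (hg : Continuous g) :
    Integrable (fun x => g x • F x) := by
  have h : IntegrableOn (fun x => g x • F x) (Metric.closedBall 0 R) :=
    hF.integrableOn.continuousOn_smul hg.continuousOn (isCompact_closedBall 0 R)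
  refine (integrableOn_iff_integrable_of_support_subset fun x hx => ?_).1 h
  exact mem_closedBall_zero_iff.2 (hR x fun h0 => hx (by simp [h0]))

/-- If all integrals against ridge functions `φ (ξ x)` vanish for `ξ` in an open set, then so do
their moments. -/
theorem integral_pow_smul_eq_zero {F : V → ℂ} (hF : Integrable F) {R : ℝ}
    (hR : ∀ x, F x ≠ 0 → ‖x‖ ≤ R) {B : Set (StrongDual ℝ V)} (hB : IsOpen B)
    (h0 : ∀ φ : ℝ → ℝ, Continuous φ → (∀ t ≤ 1, φ t = 0) → ∀ ξ ∈ B,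
      ∫ x, φ (ξ x) • F x = 0) (η : StrongDual ℝ V) (k : ℕ) :
    ∀ φ : ℝ → ℝ, Continuous φ → (∀ t ≤ 1, φ t = 0) → ∀ ξ ∈ B,
      ∫ x, ((η x) ^ k * φ (ξ x)) • F x = 0 := by
  induction k with
  | zero => simpa using h0
  | succ k ih =>
    intro φ hφ hφ1 ξ hξ
    -- The antiderivative based at `1` also vanishes on `(-∞, 1]`, so the induction hypothesis
    -- applies to `ψ`. Differentiating along `ξ + s • η` at `s = 0` turns `ψ` into `φ` and produces
    -- one more factor `η x`.
    set ψ : ℝ → ℝ := fun t => ∫ u in (1 : ℝ)..t, φ u with hψ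
    have hψd : ∀ t, HasDerivAt ψ (φ t) t := fun t =>
      intervalIntegral.integral_hasDerivAt_right (hφ.intervalIntegrable _ _)
        hφ.stronglyMeasurable.stronglyMeasurableAtFilter hφ.continuousAt
    have hψc : Continuous ψ := continuous_iff_continuousAt.2 fun t => (hψd t).continuousAt
    have hψ1 : ∀ t ≤ 1, ψ t = 0 := by
      intro t ht
      refine intervalIntegral.integral_zero_ae (Filter.Eventually.of_forall fun u hu => hφ1 u ?_)
      rw [uIoc_of_ge ht] at hu
      exact hu.2
    obtain ⟨C, hC⟩ := ((isCompact_closedBall (0 : V) R).prod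
      (isCompact_Icc (a := (-1 : ℝ)) (b := 1))).exists_bound_of_continuousOn
      (f := fun q : V × ℝ => (η q.1) ^ (k + 1) * φ (ξ q.1 + q.2 * η q.1))
      (by fun_prop)
    have hder := (hasDerivAt_integral_of_dominated_loc_of_deriv_le (μ := (volume : Measure V))
      (F := fun (s : ℝ) x => ((η x) ^ k * ψ (ξ x + s * η x)) • F x)
      (F' := fun (s : ℝ) x => ((η x) ^ (k + 1) * φ (ξ x + s * η x)) • F x)
      (x₀ := 0) (s := Icc (-1) 1) (bound := fun x => C * ‖F x‖)
      (Icc_mem_nhds (by norm_num) (by norm_num))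
      (Filter.Eventually.of_forall fun s =>
        (integrable_smul_of_bounded_support hF hR (by fun_prop)).aestronglyMeasurable)
      (integrable_smul_of_bounded_support hF hR (by fun_prop))
      (integrable_smul_of_bounded_support hF hR (by fun_prop)).aestronglyMeasurable
      (Filter.Eventually.of_forall fun x s hs => by
        by_cases hx : F x = 0
        · simp [hx]
        rw [norm_smul]
        gcongr
        exact hC (x, s) ⟨mem_closedBall_zero_iff.2 (hR x hx), hs⟩)
      (hF.norm.const_mul C)
      (Filter.Eventually.of_forall fun x s _ => by
        have h1 : HasDerivAt (fun s : ℝ => ξ x + s * η x) (η x) s := by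
          simpa using ((hasDerivAt_id s).mul_const (η x)).const_add (ξ x)
        have h2 := ((hψd (ξ x + s * η x)).comp s h1).const_mul ((η x) ^ k)
        have h3 := h2.smul_const (F x)
        rw [show (η x) ^ (k + 1) * φ (ξ x + s * η x) = (η x) ^ k * (φ (ξ x + s * η x) * η x) by
          ring]
        exact h3)).2
    have hline : ∀ᶠ s : ℝ in 𝓝 0, ξ + s • η ∈ B := by
      have hc : ContinuousAt (fun s : ℝ => ξ + s • η) 0 := by fun_prop
      exact hc.eventually_mem (hB.mem_nhds (by simpa using hξ))
    have hzero : (fun s : ℝ => ∫ x, ((η x) ^ k * ψ (ξ x + s * η x)) • F x) =ᶠ[𝓝 0]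
        fun _ => 0 := by
      filter_upwards [hline] with s hs
      simpa using ih ψ hψc hψ1 _ hs
    have := hder.unique ((hasDerivAt_const (0 : ℝ) (0 : ℂ)).congr_of_eventuallyEq hzero)
    simpa using this

open Complex FourierTransform in
/-- A continuous function with bounded support all of whose moments vanish is zero. -/
theorem eq_zero_of_integral_pow_smul_eq_zero {H : V → ℂ} (hH : Continuous H) {R : ℝ}
    (hR : ∀ x, H x ≠ 0 → ‖x‖ ≤ R)
    (h : ∀ (η : StrongDual ℝ V) (k : ℕ), ∫ x, ((η x) ^ k) • H x = 0) : H = 0 := by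
  have hsupp : HasCompactSupport H :=
    HasCompactSupport.intro (isCompact_closedBall 0 R) fun x hx => by
      by_contra hne
      exact hx (mem_closedBall_zero_iff.2 (hR x hne))
  have hint : Integrable H := hH.integrable_of_hasCompactSupport hsupp
  have hfour : 𝓕 H = 0 := by
    funext w
    rw [Real.fourier_eq']
    set η : StrongDual ℝ V := innerSL ℝ w with hη
    have hηx : ∀ x, inner ℝ x w = η x := fun x => by simp [hη, real_inner_comm]
    -- Bounded support allows the exponential series to be integrated termwise; each term is a
    -- moment.
    have hs := hasSum_integral_of_dominated_convergence (μ := (volume : Measure V))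
      (F := fun (k : ℕ) x => (((k.factorial : ℂ)⁻¹ * (-2 * Real.pi * I) ^ k)) •
        ((η x) ^ k • H x))
      (f := fun x => exp (((-2 * Real.pi * inner ℝ x w : ℝ) : ℂ) * I) • H x)
      (fun (k : ℕ) x => (2 * Real.pi * (‖η‖ * R)) ^ k / k.factorial * ‖H x‖)
      (fun k => by
        refine Continuous.aestronglyMeasurable ?_
        fun_prop)
      (fun k => Filter.Eventually.of_forall fun x => by
        by_cases hx : H x = 0
        · simp [hx]
        have h1 : ‖η x‖ ≤ ‖η‖ * R := (η.le_opNorm x).trans (by gcongr; exact hR x hx)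
        rw [norm_smul, norm_smul, ← mul_assoc]
        gcongr
        rw [norm_mul, norm_inv, norm_pow, norm_pow, Complex.norm_natCast, div_eq_inv_mul, mul_assoc,
          ← mul_pow]
        gcongr
        have h2 : ‖(-2 * Real.pi * I : ℂ)‖ = 2 * Real.pi := by
          simp [abs_of_pos Real.pi_pos]
        rw [h2])
      (Filter.Eventually.of_forall fun x =>
        (Real.summable_pow_div_factorial _).mul_right _)
      (by
        simp_rw [tsum_mul_right]
        exact hint.norm.const_mul _)
      (Filter.Eventually.of_forall fun x => by
        have h1 := (NormedSpace.expSeries_div_hasSum_exp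
          (((-2 * Real.pi * inner ℝ x w : ℝ) : ℂ) * I)).smul_const (H x)
        rw [← Complex.exp_eq_exp_ℂ] at h1
        refine h1.congr_fun fun k => ?_
        rw [hηx, Complex.real_smul]
        push_cast
        simp only [smul_eq_mul, mul_pow, div_eq_inv_mul]
        ring)
    have hz : ∀ k : ℕ, ∫ x, (((k.factorial : ℂ)⁻¹ * (-2 * Real.pi * I) ^ k)) •
        ((η x) ^ k • H x) = 0 := fun k => by
      rw [integral_smul, h η k, smul_zero]
    simp_rw [hz] at hs
    exact hs.unique hasSum_zero
  have hinv := hH.fourierInv_fourier_eq hint (by rw [hfour]; exact integrable_zero _ _ _)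
  rw [← hinv, hfour]
  funext v
  simp [Real.fourierInv_eq]

end Moments

/-! ### The local support theorem and the component of `0` -/

section Support

variable {n : ℕ}

theorem integral_hyperplaneMeasure_eq_radonM (f : Punctured (E n) → ℂ) (ξ : EDual n) {t : ℝ}
    (ht : 0 < t) :
    ∫ x, zeroExt f x ∂(hyperplaneMeasure ξ t) = t⁻¹ • zeroExt (radonM f) (t⁻¹ • ξ) := by
  rw [zeroExt_radonM, hyperplaneMeasure_smul ξ ht, integral_smul_measure,
    ENNReal.toReal_ofReal ht.le, smul_smul, inv_mul_cancel₀ ht.ne', one_smul]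

/-- The cutoff is needed because `f` may fail to be integrable near `0`. -/
theorem integrable_indicator_zeroExt {f : Punctured (E n) → ℂ} (hf : f ∈ smoothBounded (E n))
    {δ : ℝ} (hδ : 0 < δ) : Integrable ({x | δ ≤ ‖x‖}.indicator (zeroExt f)) := by
  obtain ⟨R, hR0, hR⟩ := smoothBounded.exists_bound hf
  have hcl : IsClosed {x : E n | δ ≤ ‖x‖} := isClosed_le continuous_const continuous_norm
  have hc : IsCompact (Metric.closedBall (0 : E n) R ∩ {x | δ ≤ ‖x‖}) :=
    (isCompact_closedBall 0 R).inter_right hcl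
  have hcont : ContinuousOn (zeroExt f) (Metric.closedBall (0 : E n) R ∩ {x | δ ≤ ‖x‖}) := by
    refine hf.1.continuousOn.mono fun x hx => ?_
    rintro rfl
    have : δ ≤ ‖(0 : E n)‖ := hx.2
    rw [norm_zero] at this
    exact absurd this (not_le.2 hδ)
  have heq : {x | δ ≤ ‖x‖}.indicator (zeroExt f) =
      (Metric.closedBall (0 : E n) R ∩ {x | δ ≤ ‖x‖}).indicator (zeroExt f) := by
    funext x
    by_cases hx : x ∈ Metric.closedBall (0 : E n) R
    · simp [Set.indicator, hx]
    · have : zeroExt f x = 0 := by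
        by_contra h
        exact hx (mem_closedBall_zero_iff.2 (hR x h))
      simp [Set.indicator, this]
  rw [heq, integrable_indicator_iff hc.measurableSet]
  exact hcont.integrableOn_compact hc

/-- The local support theorem: if `Mf` vanishes on the segments from `0` to the points of a ball,
then `f` vanishes on the half-spaces `⟨ξ, x⟩ > 1` with `ξ` in that ball. -/
theorem zeroExt_eq_zero_of_radonM_eq_zero {f : Punctured (E n) → ℂ}
    (hf : f ∈ smoothBounded (E n)) {ξ₀ : EDual n} {r : ℝ}
    (h : ∀ ξ ∈ Metric.ball ξ₀ r, ∀ s ∈ Ioc (0 : ℝ) 1, zeroExt (radonM f) (s • ξ) = 0)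
    {ξ : EDual n} (hξ : ξ ∈ Metric.ball ξ₀ r) {x : E n} (hx : 1 < ξ x) : zeroExt f x = 0 := by
  obtain ⟨R, hR0, hR⟩ := smoothBounded.exists_bound hf
  have hr : 0 < r := Metric.pos_of_mem_ball hξ
  have hM : 0 < ‖ξ₀‖ + r := by positivity
  -- Every half-space `ζ y ≥ 1` with `ζ` in the ball stays at distance at least `δ` from `0`, so
  -- cutting `f` off below `δ` changes nothing there.
  set δ := (‖ξ₀‖ + r)⁻¹ with hδ
  have hδ0 : 0 < δ := by positivity
  have hfar : ∀ ζ ∈ Metric.ball ξ₀ r, ∀ y : E n, 1 ≤ ζ y → δ ≤ ‖y‖ := by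
    intro ζ hζ y hy
    have h1 : ‖ζ‖ ≤ ‖ξ₀‖ + r := by
      have := norm_le_norm_add_norm_sub' ζ ξ₀
      rw [Metric.mem_ball, dist_eq_norm] at hζ
      linarith
    rw [hδ, inv_le_iff_one_le_mul₀' hM]
    calc 1 ≤ ζ y := hy
      _ ≤ ‖ζ‖ * ‖y‖ := (le_abs_self _).trans (ζ.le_opNorm y)
      _ ≤ _ := by gcongr
  set F : E n → ℂ := {x | δ ≤ ‖x‖}.indicator (zeroExt f) with hF
  have hFint : Integrable F := integrable_indicator_zeroExt hf hδ0
  have hFR : ∀ y, F y ≠ 0 → ‖y‖ ≤ R := fun y hy =>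
    hR y (Set.indicator_apply_ne_zero.1 hy).2
  have hFf : ∀ ζ ∈ Metric.ball ξ₀ r, ∀ y : E n, 1 ≤ ζ y → F y = zeroExt f y :=
    fun ζ hζ y hy => Set.indicator_of_mem (s := {x | δ ≤ ‖x‖}) (hfar ζ hζ y hy) _
  have base : ∀ φ : ℝ → ℝ, Continuous φ → (∀ t ≤ 1, φ t = 0) → ∀ ζ ∈ Metric.ball ξ₀ r,
      ∫ y, φ (ζ y) • F y = 0 := by
    intro φ hφ hφ1 ζ hζ
    rcases eq_or_ne ζ 0 with rfl | hζ0
    · simp [hφ1 0 zero_le_one]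
    rw [← integral_integral_hyperplaneMeasure hζ0
      (integrable_smul_of_bounded_support hFint hFR (by fun_prop))]
    refine integral_eq_zero_of_ae (Filter.Eventually.of_forall fun t => ?_)
    rcases le_or_gt t 1 with ht | ht
    · refine integral_eq_zero_of_ae ((ae_hyperplaneMeasure hζ0 t).mono fun y hy => ?_)
      simp [hy, hφ1 t ht]
    · have h1 : ∫ y, φ (ζ y) • F y ∂(hyperplaneMeasure ζ t) =
          ∫ y, φ t • zeroExt f y ∂(hyperplaneMeasure ζ t) := by
        refine integral_congr_ae ((ae_hyperplaneMeasure hζ0 t).mono fun y hy => ?_)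
        simp only [hy, hFf ζ hζ y (by rw [hy]; exact ht.le)]
      have ht0 : 0 < t := one_pos.trans ht
      simp only [Pi.zero_apply]
      rw [h1, integral_smul, integral_hyperplaneMeasure_eq_radonM f ζ ht0,
        h ζ hζ t⁻¹ ⟨inv_pos.2 ht0, inv_le_one_of_one_le₀ ht.le⟩, smul_zero, smul_zero]
  -- Positivity for `t > 1` allows division by `φ (ξ x)` at the end; continuity and vanishing for `t
  -- ≤ 1` make `φ (ξ y) • F y` continuous despite the cutoff.
  set φ : ℝ → ℝ := fun t => max (t - 1) 0 with hφ
  have hφc : Continuous φ := by fun_prop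
  have hφ1 : ∀ t ≤ 1, φ t = 0 := fun t ht => max_eq_right (by linarith)
  have hHf : ∀ y, φ (ξ y) • F y = φ (ξ y) • zeroExt f y := by
    intro y
    rcases le_or_gt (ξ y) 1 with hy | hy
    · simp [hφ1 _ hy]
    · rw [hFf ξ hξ y hy.le]
  have hcont : Continuous (fun y => φ (ξ y) • F y) := by
    simp_rw [hHf]
    rw [continuous_iff_continuousAt]
    intro y
    rcases eq_or_ne y 0 with rfl | hy
    · have hev : ∀ᶠ y in 𝓝 (0 : E n), ξ y < 1 :=
        ξ.continuous.continuousAt.eventually_lt continuousAt_const (by simp)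
      refine (continuousAt_const (y := (0 : ℂ))).congr ?_
      filter_upwards [hev] with y hy
      simp [hφ1 _ hy.le]
    · have h1 : ContinuousAt (zeroExt f) y :=
        hf.1.continuousOn.continuousAt (isOpen_compl_singleton.mem_nhds hy)
      exact (hφc.comp ξ.continuous).continuousAt.smul h1
  have hzero := eq_zero_of_integral_pow_smul_eq_zero hcont (R := R)
    (fun y hy => hFR y fun h0 => hy (by simp [h0])) fun η k => by
      simp_rw [smul_smul]
      exact integral_pow_smul_eq_zero hFint hFR Metric.isOpen_ball base η k φ hφc hφ1 ξ hξ
  have hx0 := congrFun hzero x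
  simp only [hHf, Pi.zero_apply] at hx0
  refine (smul_eq_zero.1 hx0).resolve_left (ne_of_gt ?_)
  exact lt_max_of_lt_left (by linarith)

/-- The covectors `ξ` such that `f` vanishes on the half-space `⟨ξ, x⟩ > 1`. -/
def polarSupport (f : Punctured (E n) → ℂ) : Set (EDual n) :=
  {ξ | ∀ x, 1 < ξ x → zeroExt f x = 0}

/-- The set is an intersection of half-spaces `ξ x ≤ 1`, one for each `x` with `f x ≠ 0`. -/
theorem convex_polarSupport (f : Punctured (E n) → ℂ) : Convex ℝ (polarSupport f) := by
  intro ξ hξ ζ hζ a b ha hb hab x hx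
  by_contra hne
  have h1 : ξ x ≤ 1 := not_lt.1 fun h => hne (hξ x h)
  have h2 : ζ x ≤ 1 := not_lt.1 fun h => hne (hζ x h)
  simp only [add_apply, smul_apply, smul_eq_mul] at hx
  nlinarith

theorem zero_mem_interior_polarSupport {f : Punctured (E n) → ℂ}
    (hf : f ∈ smoothBounded (E n)) : (0 : EDual n) ∈ interior (polarSupport f) := by
  obtain ⟨R, hR0, hR⟩ := smoothBounded.exists_bound hf
  rw [mem_interior_iff_mem_nhds]
  filter_upwards [Metric.ball_mem_nhds (0 : EDual n) (inv_pos.2 hR0)] with ξ hξ x hx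
  by_contra hne
  have h1 : ‖ξ‖ < R⁻¹ := mem_ball_zero_iff.1 hξ
  have h2 : ξ x ≤ 1 := calc
    ξ x ≤ ‖ξ‖ * ‖x‖ := (le_abs_self _).trans (ξ.le_opNorm x)
    _ ≤ R⁻¹ * R := by gcongr; exact hR x hne
    _ = 1 := inv_mul_cancel₀ hR0.ne'
  linarith

theorem radonM_eq_zero_of_mem_interior {f : Punctured (E n) → ℂ} {ξ : EDual n}
    (hξ : ξ ∈ interior (polarSupport f)) : zeroExt (radonM f) ξ = 0 := by
  refine zeroExt_radonM_eq_zero fun x hx => ?_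
  have hc : ContinuousAt (fun s : ℝ => s • ξ) 1 := by fun_prop
  have hev : ∀ᶠ s in 𝓝 (1 : ℝ), s • ξ ∈ interior (polarSupport f) :=
    hc.eventually_mem (isOpen_interior.mem_nhds (by simpa using hξ))
  -- For `s > 1` close to `1`, the hyperplane `ξ x = 1` lies in the open half-space `(s • ξ) x > 1`,
  -- where `f` vanishes.
  obtain ⟨s, hs, hs1⟩ := ((hev.filter_mono nhdsWithin_le_nhds).and
    (self_mem_nhdsWithin (s := Ioi (1 : ℝ)))).exists
  exact interior_subset hs x (by simpa [hx] using hs1)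

/-- The interior is convex, hence connected, and `Mf` vanishes on it. Conversely it is open and, by
the local support theorem, relatively closed in the component. -/
theorem connectedComponentIn_compl_tsupport_radonM {f : Punctured (E n) → ℂ}
    (hf : f ∈ smoothBounded (E n)) :
    connectedComponentIn (tsupport (zeroExt (radonM f)))ᶜ 0 = interior (polarSupport f) := by
  have hconv : Convex ℝ (interior (polarSupport f)) := (convex_polarSupport f).interior
  have h0 := zero_mem_interior_polarSupport hf
  have hsub : interior (polarSupport f) ⊆ (tsupport (zeroExt (radonM f)))ᶜ := fun ξ hξ =>
    notMem_tsupport_iff_eventuallyEq.2 <| by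
      filter_upwards [isOpen_interior.mem_nhds hξ] with ζ hζ
      exact radonM_eq_zero_of_mem_interior hζ
  refine Subset.antisymm ?_ (hconv.isPreconnected.subset_connectedComponentIn h0 hsub)
  refine isPreconnected_connectedComponentIn.subset_of_closure_inter_subset isOpen_interior
    ⟨0, mem_connectedComponentIn (hsub h0), h0⟩ ?_
  rintro ξ₀ ⟨hcl, hC⟩
  have hξ₀ := connectedComponentIn_subset _ _ hC
  obtain ⟨ε, hε, hball⟩ := Metric.eventually_nhds_iff_ball.1
    (notMem_tsupport_iff_eventuallyEq.1 hξ₀)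
  -- `τ` splits each segment from `0` to `ζ` near `ξ₀`: for `s ≤ 1 - τ` the point `s • ζ` lies in
  -- the interior of the polar set, and for `s ≥ 1 - τ` it lies in the `ε`-ball around `ξ₀` where
  -- `Mf` vanishes.
  obtain ⟨τ, hτ0, hτ1, hτε⟩ : ∃ τ : ℝ, 0 < τ ∧ τ < 1 ∧ τ * ‖ξ₀‖ ≤ ε / 2 := by
    refine ⟨min (1 / 2) (ε / 2 / (‖ξ₀‖ + 1)), by positivity,
      (min_le_left _ _).trans_lt (by norm_num), ?_⟩
    calc _ ≤ ε / 2 / (‖ξ₀‖ + 1) * (‖ξ₀‖ + 1) := by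
            gcongr
            · exact min_le_right _ _
            · linarith
      _ = ε / 2 := by field_simp
  have hs₀ : 0 < 1 - τ := by linarith
  have hin : (1 - τ) • ξ₀ ∈ interior (polarSupport f) := by
    have hcl' : ξ₀ ∈ closure (polarSupport f) := closure_mono interior_subset hcl
    refine (convex_polarSupport f).openSegment_closure_interior_subset_interior hcl' h0
      ⟨1 - τ, τ, hs₀, hτ0, by ring, by simp⟩
  obtain ⟨ρ, hρ, hballρ⟩ := Metric.isOpen_iff.1 isOpen_interior _ hin
  have hr : 0 < min (ε / 2) ρ := lt_min (by positivity) hρ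
  refine mem_interior.2 ⟨Metric.ball ξ₀ (min (ε / 2) ρ), fun ξ hξ x hx => ?_, Metric.isOpen_ball,
    Metric.mem_ball_self hr⟩
  refine zeroExt_eq_zero_of_radonM_eq_zero hf (fun ζ hζ s hs => ?_) hξ hx
  rw [mem_ball_iff_norm] at hζ
  have hζε := hζ.trans_le (min_le_left _ _)
  have hζρ := hζ.trans_le (min_le_right _ _)
  rcases le_total s (1 - τ) with hle | hle
  · have h1 : (1 - τ) • ζ ∈ interior (polarSupport f) := by
      refine hballρ ?_
      have h3 : (1 - τ) • ζ - (1 - τ) • ξ₀ = (1 - τ) • (ζ - ξ₀) := by module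
      rw [mem_ball_iff_norm, h3, norm_smul, Real.norm_of_nonneg hs₀.le]
      nlinarith [norm_nonneg (ζ - ξ₀)]
    have h2 := hconv.smul_mem_of_zero_mem h0 h1 (t := s / (1 - τ))
      ⟨div_nonneg hs.1.le hs₀.le, (div_le_one hs₀).2 hle⟩
    rw [smul_smul, div_mul_cancel₀ _ hs₀.ne'] at h2
    exact radonM_eq_zero_of_mem_interior h2
  · refine hball _ ?_
    rw [mem_ball_iff_norm]
    have h1 : s • ζ - ξ₀ = s • (ζ - ξ₀) - (1 - s) • ξ₀ := by module
    rw [h1]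
    refine (norm_sub_le _ _).trans_lt ?_
    rw [norm_smul, norm_smul, Real.norm_of_nonneg hs.1.le, Real.norm_of_nonneg (by linarith [hs.2])]
    nlinarith [norm_nonneg (ζ - ξ₀), norm_nonneg ξ₀, hs.2]

theorem convex_connectedComponentIn_compl_tsupport_radonM {f : Punctured (E n) → ℂ}
    (hf : f ∈ smoothBounded (E n)) :
    Convex ℝ (connectedComponentIn (tsupport (zeroExt (radonM f)))ᶜ 0) := by
  rw [connectedComponentIn_compl_tsupport_radonM hf]
  exact (convex_polarSupport f).interior

end Support

/-! ### Failure of surjectivity -/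

/-- In dimension at least two there is a function in `smoothAway` for which the component of `0` in
the complement of the support is not convex: a bump around a point `α`, where `0` and `2α` are
joined by a path around `α`. -/
theorem exists_smoothAway_not_convex {V : Type*} [NormedAddCommGroup V] [NormedSpace ℝ V]
    [FiniteDimensional ℝ V] (hV : 1 < Module.finrank ℝ V) :
    ∃ g ∈ smoothAway V, ¬ Convex ℝ (connectedComponentIn (tsupport (zeroExt g))ᶜ 0) := by
  have : Nontrivial V := Module.nontrivial_of_finrank_pos (R := ℝ) (by omega)
  obtain ⟨α, hα⟩ := exists_ne (0 : V)
  obtain ⟨β, hαβ⟩ := exists_linearIndependent_pair_of_one_lt_finrank hV hα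
  rw [LinearIndependent.pair_iff] at hαβ
  -- The broken line through `α + β` misses `α` by linear independence, and closedness of `T` leaves
  -- room for a bump.
  set T : Set V := segment ℝ 0 (α + β) ∪ segment ℝ (α + β) ((2 : ℝ) • α) with hT
  have hTc : IsClosed T := by
    have : ∀ x y : V, IsClosed (segment ℝ x y) := fun x y => by
      rw [segment_eq_image_lineMap]
      exact (isCompact_Icc.image AffineMap.lineMap_continuous).isClosed
    exact (this _ _).union (this _ _)
  have hαT : α ∉ T := by
    rintro (⟨a, b, ha, hb, hab, h⟩ | ⟨a, b, ha, hb, hab, h⟩)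
    · have h1 := hαβ (b - 1) b (by rw [← sub_eq_zero.2 h]; module)
      linarith [h1.1, h1.2]
    · have h1 := hαβ (a + 2 * b - 1) a (by rw [← sub_eq_zero.2 h]; module)
      linarith [h1.1, h1.2]
  obtain ⟨ε, hε, hball⟩ := Metric.isOpen_iff.1 hTc.isOpen_compl α hαT
  let φ : ContDiffBump α := ⟨ε / 4, ε / 2, by positivity, by linarith⟩
  have h0T : (0 : V) ∈ T := Or.inl (left_mem_segment ℝ _ _)
  have hdisj : T ⊆ (Metric.closedBall α (ε / 2))ᶜ := fun x hx hxb =>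
    hball (Metric.closedBall_subset_ball (by linarith) hxb) hx
  set G : V → ℂ := fun x => (φ x : ℂ) with hG
  have hsuppG : Function.support G = Metric.ball α (ε / 2) := by
    rw [← φ.support_eq]
    ext x
    simp [hG]
  have htsupp : tsupport G = Metric.closedBall α (ε / 2) := by
    rw [tsupport, hsuppG, closure_ball _ (by positivity)]
  have hG0 : G 0 = 0 := by
    by_contra h
    have h' : (0 : V) ∈ Metric.ball α (ε / 2) := hsuppG ▸ h
    exact hdisj h0T (Metric.ball_subset_closedBall h')
  refine ⟨fun x => G x, ⟨?_, ?_⟩, ?_⟩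
  · rw [zeroExt_restrict hG0]
    exact (Complex.ofRealCLM.contDiff.comp φ.contDiff).contDiffOn
  · obtain ⟨r, hr, hb⟩ := Metric.isOpen_iff.1 Metric.isClosed_closedBall.isOpen_compl 0 (hdisj h0T)
    refine ⟨r, hr, fun x hx => ?_⟩
    by_contra! hlt
    have h' : (x : V) ∈ Metric.ball α (ε / 2) := hsuppG ▸ hx
    exact hb (mem_ball_zero_iff.2 hlt) (Metric.ball_subset_closedBall h')
  · rw [zeroExt_restrict hG0, htsupp]
    intro hconv
    have hTpre : IsPreconnected T :=
      (convex_segment _ _).isPreconnected.union (α + β) (right_mem_segment ℝ _ _)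
        (left_mem_segment ℝ _ _) (convex_segment _ _).isPreconnected
    have hsub := hTpre.subset_connectedComponentIn h0T hdisj
    have h2 : (2 : ℝ) • α ∈ T := Or.inr (right_mem_segment ℝ _ _)
    have hmid := hconv (hsub h0T) (hsub h2) (a := 1 / 2) (b := 1 / 2) (by norm_num) (by norm_num)
      (by norm_num)
    have hα' : (1 / 2 : ℝ) • (0 : V) + (1 / 2 : ℝ) • (2 : ℝ) • α = α := by module
    rw [hα'] at hmid
    exact connectedComponentIn_subset _ _ hmid (Metric.mem_closedBall_self (by positivity))

end Radon

theorem corollary4p7 (n : ℕ) (hn : 2 ≤ n) :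
    -- the transform is an operator between the two function spaces
    Set.MapsTo (Radon.radonM (n := n))
      (Radon.smoothBounded (Radon.E n)) (Radon.smoothAway (Radon.EDual n)) ∧
    -- it is not surjective
    ¬ Set.SurjOn (Radon.radonM (n := n))
      (Radon.smoothBounded (Radon.E n)) (Radon.smoothAway (Radon.EDual n)) ∧
    -- the component of `0` in the complement of `supp (Mf)` is convex
    ∀ f ∈ Radon.smoothBounded (Radon.E n),
      (0 : Radon.EDual n) ∈ (tsupport (Radon.zeroExt (Radon.radonM f)))ᶜ ∧
      Convex ℝ (connectedComponentIn (tsupport (Radon.zeroExt (Radon.radonM f)))ᶜ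
        (0 : Radon.EDual n)) := by
  refine ⟨fun f hf => Radon.radonM_mem_smoothAway hf, fun hsurj => ?_, fun f hf =>
    ⟨Radon.smoothAway.zero_notMem_tsupport (Radon.radonM_mem_smoothAway hf),
      Radon.convex_connectedComponentIn_compl_tsupport_radonM hf⟩⟩
  have hrank : 1 < Module.finrank ℝ (Radon.EDual n) := by
    rw [← (InnerProductSpace.toDual ℝ (Radon.E n)).toLinearEquiv.finrank_eq,
      finrank_euclideanSpace_fin]
    omega
  obtain ⟨g, hg, hnc⟩ := Radon.exists_smoothAway_not_convex hrank
  obtain ⟨f, hf, rfl⟩ := hsurj hg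
  exact hnc (Radon.convex_connectedComponentIn_compl_tsupport_radonM hf)
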